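/- Let $q$ be a prime power, let $\mathbb F_q$ be the finite field with $q$ elements, and for a nonzero $f\in\mathbb F_q[t]$ let $\Omega(f)$ be the number of monic irreducible factors of $f$ counted with multiplicity. For $n\ge 1$ let $\widetilde{\mathcal M}_n$ be the set of monic polynomials of degree $n$ in $\mathbb F_q[t]$ having no root in $\mathbb F_q$. For $|z|<q^2$ put $$h(z)=\frac{1}{\Gamma(z+1)}\left(1-\frac1q\right)^{qz}\prod_{P}\left(1-\frac{z}{q^{\deg P}}\right)^{-1}\left(1-\frac{1}{q^{\deg P}}\right)^{z},$$ where $P$ runs over the monic irreducible polynomials in $\mathbb F_q[t]$ of degree at least $2$ and $1/\Gamma$ denotes the entire reciprocal Gamma function. Then the product converges (unconditionally) for every complex $z$ with $|z|<q^2$, and $h$ is analytic in the disc $|z|<q^2$. Moreover, for every $\delta\in(0,1)$ there is a constant $C$, depending only on $q$ and $\delta$, such that for all integers $n\ge1$ and all complex $z$ with $|z|\le q^2-\delta$, $$\sum_{f\in\widetilde{\mathcal M}_n}z^{\Omega(f)}=q^n n^{z-1}\bigl(zh(z)+\varepsilon_n(z)\bigr)\quad\text{for some }\varepsilon_n(z)\in\mathbb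 C\text{ with }|\varepsilon_n(z)|\le\frac{C}{n}.$$ -/

import Mathlib

/-- `Ω(f)`: the number of irreducible factors of `f`, counted with multiplicity. -/
noncomputable def polyOmega {F : Type*} [Field F] (f : Polynomial F) : ℕ :=
  Multiset.card (UniqueFactorizationMonoid.factors f)

/-- The monic polynomials of degree `n` over `F` having no root in `F`. -/
def rootFreeMonic (F : Type*) [Field F] (n : ℕ) : Set (Polynomial F) :=
  {f | f.Monic ∧ f.natDegree = n ∧ ∀ a : F, ¬ f.IsRoot a}

theorem rootFreeMonic_finite (F : Type*) [Field F] [Finite F] (n : ℕ) :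
    (rootFreeMonic F n).Finite := by
  refine Set.Finite.of_injOn (f := fun (p : Polynomial F) (i : Fin (n + 1)) => p.coeff i)
    (t := Set.univ) (fun _ _ => Set.mem_univ _) ?_ Set.finite_univ
  rintro p ⟨-, hp, -⟩ r ⟨-, hr, -⟩ h
  ext i
  by_cases hi : i < n + 1
  · exact congrFun h ⟨i, hi⟩
  · rw [Polynomial.coeff_eq_zero_of_natDegree_lt (by omega),
      Polynomial.coeff_eq_zero_of_natDegree_lt (by omega)]

/-- The sum of `z ^ Ω(f)` over the monic polynomials `f` of degree `n` with no root in `F`. -/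
noncomputable def rootFreeSum (F : Type*) [Field F] [Finite F] (n : ℕ) (z : ℂ) : ℂ :=
  ∑ f ∈ (rootFreeMonic_finite F n).toFinset, z ^ polyOmega f

/-- The monic irreducible polynomials over `F` of degree at least two. -/
def PrimesGeTwo (F : Type*) [Field F] : Type _ :=
  {P : Polynomial F // P.Monic ∧ Irreducible P ∧ 2 ≤ P.natDegree}

/-- The Euler factor `(1 - z / q ^ deg P)⁻¹ (1 - 1 / q ^ deg P) ^ z`, where `q = #F`. The base of
the complex power is a positive real number. -/
noncomputable def eulerFactor (F : Type*) [Field F] (z : ℂ) (P : PrimesGeTwo F) : ℂ :=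
  (1 - z / (Nat.card F : ℂ) ^ P.1.natDegree)⁻¹ *
    (1 - 1 / (Nat.card F : ℂ) ^ P.1.natDegree) ^ z

/-- The function `h`. Mathlib's `Complex.Gamma` is `0` at its poles, so `1 / Gamma (z + 1)` is the
entire reciprocal Gamma function. -/
noncomputable def hFun (F : Type*) [Field F] (z : ℂ) : ℂ :=
  1 / Complex.Gamma (z + 1) * (1 - 1 / (Nat.card F : ℂ)) ^ ((Nat.card F : ℂ) * z) *
    ∏' P : PrimesGeTwo F, eulerFactor F z P

/-! This is the Selberg–Delange method, made elementary by the rationality of the zeta function of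
`F[t]`. By unique factorisation, for small `t`, the generating function of `rootFreeSum F n z` is
the product of `(1 - z t ^ deg P)⁻¹` over monic irreducibles of degree at least two
(`exists_hasSum_rootFreeSum`). At `z = 1` it equals `(1 - t) ^ q / (1 - q t)`
(`hasSum_rootFreeSum_one`). Dividing by the `z`-th power of this and putting `u = q t` leaves `(1 -
u) ^ (-z) * regularPart F z u` (`hasSum_rootFreeSum`).

The factors of `regularPart` are `1 + O(|u / q| ^ (2 deg P))`, and degree one is absent. Hence for
`|z| ≤ R < q ^ 2` it is analytic and uniformly bounded on a disc of radius larger than `1`, and its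
Taylor coefficients decay geometrically, uniformly in `z` (`exists_taylor_regularPart`).

The coefficient of `u ^ n` in `(1 - u) ^ (-z)` is `Ring.multichoose z n = n ^ (z - 1) * (1 / Γ(z) +
O(1 / n))`. Convolution with a geometrically decaying sequence preserves this shape and multiplies
the main term by the value at `u = 1` (`exists_coeff_bound`). No contour integral is needed: partial
summation suffices. Finally `1 / Γ(z) = z / Γ(z + 1)` produces `z * h(z)`. -/

/-! ### Coefficients of `(1 - u) ^ (-z)` -/

open Filter Topology Finset in
theorem factorial_mul_multichoose (z : ℂ) (n : ℕ) :
    (n.factorial : ℂ) * Ring.multichoose z n = ∏ j ∈ range n, (z + j) := by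
  have h := Ring.factorial_nsmul_multichoose_eq_ascPochhammer z n
  rw [nsmul_eq_mul] at h
  rw [h, Polynomial.ascPochhammer_smeval_eq_eval]
  clear h
  induction n with
  | zero => simp
  | succ n ih => rw [ascPochhammer_succ_eval, ih, prod_range_succ]

theorem multichoose_succ_right (z : ℂ) (n : ℕ) :
    ((n : ℂ) + 1) * Ring.multichoose z (n + 1) = (z + n) * Ring.multichoose z n := by
  have h1 := factorial_mul_multichoose z n
  have h2 := factorial_mul_multichoose z (n + 1)
  rw [Finset.prod_range_succ, ← h1, Nat.factorial_succ] at h2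
  have h3 : (n.factorial : ℂ) ≠ 0 := by exact_mod_cast n.factorial_ne_zero
  apply mul_left_cancel₀ h3
  push_cast at h2
  linear_combination h2

theorem multichoose_sub_one_succ (z : ℂ) (n : ℕ) :
    Ring.multichoose (z - 1) (n + 1) = Ring.multichoose z (n + 1) - Ring.multichoose z n := by
  have h := Ring.multichoose_succ_succ (z - 1) n
  rw [sub_add_cancel] at h
  rw [h]; ring

/-- Here `l` plays the role of `log (1 + v)`. Keeping it abstract lets one estimate serve both the
real logarithm at `v = 1 / n` and the complex one in the Euler factors. -/
theorem norm_exp_mul_sub_one_sub_le {R : ℝ} {z l v : ℂ} (hz : ‖z‖ ≤ R) (hv : ‖v‖ ≤ 1)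
    (hl : ‖l - v‖ ≤ ‖v‖ ^ 2) :
    ‖Complex.exp (z * l) - 1 - z * v‖ ≤ (4 * R ^ 2 * Real.exp (2 * R) + R) * ‖v‖ ^ 2 := by
  have hR : 0 ≤ R := (norm_nonneg z).trans hz
  have h1 : ‖l‖ ≤ 2 * ‖v‖ := by
    have := norm_add_le (l - v) v
    rw [sub_add_cancel] at this
    nlinarith [norm_nonneg v]
  have h2 : ‖z * l‖ ≤ R * (2 * ‖v‖) := by
    rw [norm_mul]; gcongr
  have h3 := Complex.norm_exp_sub_sum_le_norm_mul_exp (z * l) 2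
  simp only [Finset.sum_range_succ, Finset.range_zero, Finset.sum_empty, pow_zero,
    Nat.factorial_zero, Nat.cast_one, div_one, pow_one, Nat.factorial_one, zero_add] at h3
  have h4 : ‖z * l‖ ^ 2 * Real.exp ‖z * l‖ ≤ (R * (2 * ‖v‖)) ^ 2 * Real.exp (2 * R) := by
    gcongr
    nlinarith
  have h5 : ‖z * (l - v)‖ ≤ R * ‖v‖ ^ 2 := by
    rw [norm_mul]; gcongr
  calc ‖Complex.exp (z * l) - 1 - z * v‖
      = ‖(Complex.exp (z * l) - (1 + z * l)) + z * (l - v)‖ := by congr 1; ring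
    _ ≤ _ := norm_add_le _ _
    _ ≤ (R * (2 * ‖v‖)) ^ 2 * Real.exp (2 * R) + R * ‖v‖ ^ 2 := add_le_add (h3.trans h4) h5
    _ = _ := by ring

theorem abs_log_one_add_sub_self_le {x : ℝ} (hx : 0 ≤ x) : |Real.log (1 + x) - x| ≤ x ^ 2 := by
  have h1 := Real.log_le_sub_one_of_pos (show 0 < 1 + x by linarith)
  have h2 := Real.one_sub_inv_le_log_of_pos (show 0 < 1 + x by linarith)
  have h3 : 1 - (1 + x)⁻¹ = x / (1 + x) := by field_simp; ring
  have h4 : x - x ^ 2 ≤ x / (1 + x) := by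
    rw [le_div_iff₀ (by linarith)]; nlinarith [pow_nonneg hx 3]
  rw [abs_le]; constructor <;> nlinarith

/-- The normalised coefficient of `(1 - u) ^ (-z)`. -/
noncomputable def scaledMultichoose (z : ℂ) (n : ℕ) : ℂ :=
  Ring.multichoose z n * (n : ℂ) ^ (1 - z)

/-- The ratio of consecutive terms is `(1 + z / n) * (1 + 1 / n) ^ (-z)`, whose first-order terms in
`1 / n` cancel. -/
theorem norm_scaledMultichoose_succ_sub_le {R : ℝ} {z : ℂ} (hz : ‖z‖ ≤ R) {n : ℕ} (hn : 1 ≤ n) :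
    ‖scaledMultichoose z (n + 1) - scaledMultichoose z n‖ ≤
      (Real.exp (2 * R) * (4 * R ^ 2 * Real.exp (2 * R) + R)) / (n : ℝ) ^ 2 *
        ‖scaledMultichoose z n‖ := by
  have hn0 : (0 : ℝ) < n := by exact_mod_cast hn
  have hR : 0 ≤ R := (norm_nonneg z).trans hz
  have hnc : (n : ℂ) ≠ 0 := by exact_mod_cast hn0.ne'
  set x : ℝ := 1 / n with hx
  have hx0 : 0 < x := by positivity
  have hx1 : x ≤ 1 := by
    rw [hx, div_le_one hn0]; exact_mod_cast hn
  set l : ℝ := Real.log (1 + x) with hl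
  have hlx := abs_log_one_add_sub_self_le hx0.le
  have hnv : ‖(x : ℂ)‖ = x := by simp [abs_of_pos hx0]
  have hll : ‖(l : ℂ) - x‖ ≤ ‖(x : ℂ)‖ ^ 2 := by
    rw [← Complex.ofReal_sub, Complex.norm_real, hnv]; exact hlx
  have key := norm_exp_mul_sub_one_sub_le hz (by rwa [hnv]) hll
  rw [hnv] at key
  have hl2 : |l| ≤ 2 := by
    rw [abs_le] at hlx ⊢
    constructor <;> nlinarith
  have he : ‖Complex.exp (-(z * l))‖ ≤ Real.exp (2 * R) := by
    refine (Complex.norm_exp_le_exp_norm _).trans (Real.exp_le_exp.2 ?_)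
    rw [norm_neg, norm_mul, Complex.norm_real, Real.norm_eq_abs]
    nlinarith [abs_nonneg l, norm_nonneg z]
  have hpow : ((n + 1 : ℕ) : ℂ) ^ (1 - z) = (n : ℂ) ^ (1 - z) *
      ((1 + x : ℂ) * Complex.exp (-(z * l))) := by
    have h1 : ((n + 1 : ℕ) : ℂ) = ((n : ℝ) : ℂ) * ((1 + x : ℝ) : ℂ) := by
      rw [← Complex.ofReal_mul, hx, mul_add, mul_one_div_cancel hn0.ne']
      push_cast; ring
    rw [h1, Complex.mul_cpow_ofReal_nonneg hn0.le (by linarith)]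
    congr 1
    have h2 : ((1 + x : ℝ) : ℂ) ≠ 0 := by
      exact_mod_cast (by linarith : (0:ℝ) < 1 + x).ne'
    rw [Complex.cpow_def_of_ne_zero h2, ← Complex.ofReal_log (by linarith), ← hl, mul_sub, mul_one,
      sub_eq_add_neg, Complex.exp_add, mul_comm (l : ℂ) z]
    congr 1
    rw [← Complex.ofReal_exp, hl, Real.exp_log (by linarith)]
    push_cast; ring
  have hrec : scaledMultichoose z (n + 1) =
      scaledMultichoose z n * ((1 + z * x) * Complex.exp (-(z * l))) := by
    unfold scaledMultichoose
    rw [hpow]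
    have h := multichoose_succ_right z n
    have h1 : ((n : ℂ) + 1) * x = 1 + x := by rw [hx]; push_cast; field_simp
    have h2 : (z + n) * x = 1 + z * x := by rw [hx]; push_cast; field_simp; ring
    rw [← h1, ← h2]
    linear_combination (n : ℂ) ^ (1 - z) * x * Complex.exp (-(z * l)) * h
  have hdiff : scaledMultichoose z (n + 1) - scaledMultichoose z n =
      -(Complex.exp (-(z * l)) * (Complex.exp (z * l) - 1 - z * x)) * scaledMultichoose z n := by
    rw [hrec]
    have : Complex.exp (-(z * l)) * Complex.exp (z * l) = 1 := by
      rw [← Complex.exp_add]; simp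
    linear_combination scaledMultichoose z n * this
  rw [hdiff, norm_mul, norm_neg, norm_mul]
  gcongr
  calc _ ≤ Real.exp (2 * R) * ((4 * R ^ 2 * Real.exp (2 * R) + R) * x ^ 2) := by gcongr
    _ = _ := by rw [hx]; field_simp

/-- A sequence whose relative increments are `O(1 / n ^ 2)` is bounded and converges at the
rate `1 / n`. -/
theorem norm_le_and_norm_sub_le_of_increment {x : ℕ → ℂ} {K : ℝ} (hK : 0 ≤ K)
    (hx : ∀ n, 1 ≤ n → ‖x (n + 1) - x n‖ ≤ K / (n : ℝ) ^ 2 * ‖x n‖) {n : ℕ} (hn : 1 ≤ n) :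
    ‖x n‖ ≤ Real.exp (2 * K) * ‖x 1‖ ∧
      ∀ m, n ≤ m → ‖x m - x n‖ ≤ 2 * K * Real.exp (2 * K) * ‖x 1‖ / n := by
  -- A telescoping majorant, used both for boundedness and for the rate.
  have step : ∀ k : ℕ, 1 ≤ k → 1 / (k : ℝ) ^ 2 ≤ 2 / k - 2 / ((k + 1 : ℕ) : ℝ) := by
    intro k hk
    have hk' : (1 : ℝ) ≤ k := by exact_mod_cast hk
    have : 2 / (k : ℝ) - 2 / ((k + 1 : ℕ) : ℝ) = 2 / (k * (k + 1)) := by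
      push_cast; field_simp; ring
    rw [this, div_le_div_iff₀ (by positivity) (by positivity)]
    nlinarith
  -- The exponent carries the telescoped partial sum, so that the induction closes.
  have bound : ∀ k : ℕ, 1 ≤ k → ‖x k‖ ≤ Real.exp (K * (2 - 2 / k)) * ‖x 1‖ := by
    intro k hk
    induction k, hk using Nat.le_induction with
    | base => simp
    | succ k hk ih =>
      have h1 : ‖x (k + 1)‖ ≤ (K / (k : ℝ) ^ 2 + 1) * ‖x k‖ := by
        have := norm_add_le (x (k + 1) - x k) (x k)
        rw [sub_add_cancel] at this
        linarith [hx k hk]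
      calc ‖x (k + 1)‖ ≤ (K / (k : ℝ) ^ 2 + 1) * ‖x k‖ := h1
        _ ≤ Real.exp (K / (k : ℝ) ^ 2) * (Real.exp (K * (2 - 2 / k)) * ‖x 1‖) := by
            gcongr
            exact Real.add_one_le_exp _
        _ = Real.exp (K / (k : ℝ) ^ 2 + K * (2 - 2 / k)) * ‖x 1‖ := by
            rw [Real.exp_add]; ring
        _ ≤ _ := by
            gcongr
            have := mul_le_mul_of_nonneg_left (step k hk) hK
            rw [mul_one_div] at this
            linarith
  have bound' : ∀ k : ℕ, 1 ≤ k → ‖x k‖ ≤ Real.exp (2 * K) * ‖x 1‖ := by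
    intro k hk
    refine (bound k hk).trans (mul_le_mul_of_nonneg_right (Real.exp_le_exp.2 ?_) (norm_nonneg _))
    have : 0 ≤ 2 / (k : ℝ) := by positivity
    nlinarith
  refine ⟨bound' n hn, ?_⟩
  have tele : ∀ m, n ≤ m → ‖x m - x n‖ ≤
      K * (Real.exp (2 * K) * ‖x 1‖) * (2 / n - 2 / (m : ℝ)) := by
    intro m hm
    induction m, hm using Nat.le_induction with
    | base => simp
    | succ m hm ih =>
      have hm1 : 1 ≤ m := hn.trans hm
      calc ‖x (m + 1) - x n‖ = ‖(x (m + 1) - x m) + (x m - x n)‖ := by congr 1; ring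
        _ ≤ _ := norm_add_le _ _
        _ ≤ K * (Real.exp (2 * K) * ‖x 1‖) * (2 / m - 2 / ((m + 1 : ℕ) : ℝ)) +
            K * (Real.exp (2 * K) * ‖x 1‖) * (2 / n - 2 / (m : ℝ)) := by
          gcongr
          refine (hx m hm1).trans ?_
          calc K / (m : ℝ) ^ 2 * ‖x m‖ ≤ K / (m : ℝ) ^ 2 * (Real.exp (2 * K) * ‖x 1‖) := by
                gcongr; exact bound' m hm1
            _ = K * (Real.exp (2 * K) * ‖x 1‖) * (1 / (m : ℝ) ^ 2) := by ring
            _ ≤ _ := by gcongr; exact step m hm1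
        _ = _ := by ring
  intro m hm
  refine (tele m hm).trans ?_
  calc _ ≤ K * (Real.exp (2 * K) * ‖x 1‖) * (2 / n) := by
        gcongr
        have : 0 ≤ 2 / (m : ℝ) := by positivity
        linarith
    _ = _ := by ring

-- Euler's limit for Gamma, inverted. At a pole of Gamma the coefficients vanish eventually, which
-- agrees with the value `0⁻¹ = 0`.
open Filter Topology in
theorem tendsto_scaledMultichoose (z : ℂ) :
    Tendsto (scaledMultichoose z) atTop (𝓝 (Complex.Gamma z)⁻¹) := by
  by_cases hG : Complex.Gamma z = 0
  · obtain ⟨m, rfl⟩ := (Complex.Gamma_eq_zero_iff z).1 hG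
    rw [hG, inv_zero]
    refine tendsto_const_nhds.congr' ?_
    filter_upwards [eventually_gt_atTop m] with n hn
    have h := factorial_mul_multichoose (-(m : ℂ)) n
    rw [Finset.prod_eq_zero (Finset.mem_range.2 hn) (by simp)] at h
    have h3 : (n.factorial : ℂ) ≠ 0 := by exact_mod_cast n.factorial_ne_zero
    simp [scaledMultichoose, (mul_eq_zero.1 h).resolve_left h3]
  · have h1 := (Complex.GammaSeq_tendsto_Gamma z).inv₀ hG
    -- `GammaSeq` contains the extra factor `z + n`, which this quotient removes.
    have h2 : Tendsto (fun n : ℕ => 1 + z / n) atTop (𝓝 (1 + 0)) := by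
      refine tendsto_const_nhds.add ?_
      exact tendsto_const_div_atTop_nhds_zero_nat z
    have h3 := h1.div h2 (by simp)
    rw [add_zero, div_one] at h3
    refine h3.congr' ?_
    obtain ⟨N, hN⟩ := exists_nat_gt ‖z‖
    filter_upwards [eventually_ge_atTop N, eventually_gt_atTop 0] with n hn hn0
    have hnc : (n : ℂ) ≠ 0 := by exact_mod_cast hn0.ne'
    have hzn : (n : ℂ) + z ≠ 0 := by
      intro h
      have : ‖z‖ = n := by
        rw [show z = -(n : ℂ) by linear_combination h]; simp
      have h' : (N : ℝ) ≤ n := by exact_mod_cast hn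
      linarith
    have h4 : (n.factorial : ℂ) ≠ 0 := by exact_mod_cast n.factorial_ne_zero
    simp only [Pi.div_apply, Complex.GammaSeq, scaledMultichoose]
    rw [Finset.prod_range_succ, ← factorial_mul_multichoose, Complex.cpow_sub _ _ hnc,
      Complex.cpow_one]
    have h5 : (n : ℂ) ^ z ≠ 0 := by simp [Complex.cpow_eq_zero_iff, hnc]
    have h6 : (1 : ℂ) + z / n = (n + z) / n := by field_simp
    rw [h6]
    field_simp
    ring

theorem exists_scaledMultichoose_bound (R : ℝ) :
    ∃ C : ℝ, 0 ≤ C ∧ ∀ z : ℂ, ‖z‖ ≤ R → ∀ n : ℕ, 1 ≤ n →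
      ‖scaledMultichoose z n‖ ≤ C ∧ ‖scaledMultichoose z n - (Complex.Gamma z)⁻¹‖ ≤ C / n := by
  set R' := max R 0
  set K := Real.exp (2 * R') * (4 * R' ^ 2 * Real.exp (2 * R') + R') with hKdef
  have hR' : 0 ≤ R' := le_max_right _ _
  have hK : 0 ≤ K := by positivity
  refine ⟨max (Real.exp (2 * K) * R') (2 * K * Real.exp (2 * K) * R'),
    le_max_of_le_left (by positivity), fun z hz n hn => ?_⟩
  have hz' : ‖z‖ ≤ R' := hz.trans (le_max_left _ _)
  obtain ⟨h1, h2⟩ := norm_le_and_norm_sub_le_of_increment (x := scaledMultichoose z) hK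
    (fun n hn => norm_scaledMultichoose_succ_sub_le hz' hn) hn
  -- The first term of the sequence is `z` itself, so all bounds depend on `R` only.
  have h3 : ‖scaledMultichoose z 1‖ ≤ R' := by simpa [scaledMultichoose] using hz'
  constructor
  · refine (h1.trans ?_).trans (le_max_left _ _)
    gcongr
  · have h4 : Filter.Tendsto (fun m => ‖scaledMultichoose z n - scaledMultichoose z m‖)
        Filter.atTop (nhds ‖scaledMultichoose z n - (Complex.Gamma z)⁻¹‖) :=
      (tendsto_const_nhds.sub (tendsto_scaledMultichoose z)).norm
    refine le_of_tendsto h4 ?_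
    filter_upwards [Filter.eventually_ge_atTop n] with m hm
    rw [norm_sub_rev]
    refine (h2 m hm).trans ?_
    gcongr
    refine le_trans ?_ (le_max_right _ _)
    gcongr

/-! ### Convolution with a geometrically decaying sequence -/

-- Partial summation as a power series identity: `g - G = (1 - X) * H`, where `H` has coefficients
-- (partial sum of `g`) minus `G`, and multiplying by `1 - X` lowers the exponent `z` to `z - 1`.
-- With `G` the full sum, the coefficients of `H` are small.
open Finset in
theorem sum_antidiagonal_mul_multichoose (z G : ℂ) (g : ℕ → ℂ) (n : ℕ) :
    ∑ p ∈ antidiagonal n, g p.1 * Ring.multichoose z p.2 =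
      G * Ring.multichoose z n + ∑ p ∈ antidiagonal n,
        (∑ j ∈ range (p.1 + 1), g j - G) * Ring.multichoose (z - 1) p.2 := by
  have hA : (1 - PowerSeries.X) * PowerSeries.mk (fun n => Ring.multichoose z n) =
      PowerSeries.mk (fun n => Ring.multichoose (z - 1) n) := by
    ext n
    rw [sub_mul, one_mul, map_sub]
    cases n with
    | zero => simp
    | succ n =>
      rw [PowerSeries.coeff_succ_X_mul]
      simp [multichoose_sub_one_succ]
  have hH : (1 - PowerSeries.X) * PowerSeries.mk (fun k => ∑ j ∈ range (k + 1), g j - G) =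
      PowerSeries.mk g - PowerSeries.C G := by
    ext n
    rw [sub_mul, one_mul, map_sub, map_sub]
    cases n with
    | zero => simp
    | succ n =>
      rw [PowerSeries.coeff_succ_X_mul]
      simp [sum_range_succ]
  have key : PowerSeries.mk g * PowerSeries.mk (fun n => Ring.multichoose z n) =
      PowerSeries.C G * PowerSeries.mk (fun n => Ring.multichoose z n) +
        PowerSeries.mk (fun k => ∑ j ∈ range (k + 1), g j - G) *
          PowerSeries.mk (fun n => Ring.multichoose (z - 1) n) := by
    rw [← hA]
    linear_combination -PowerSeries.mk (fun n => Ring.multichoose z n) * hH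
  have := congrArg (PowerSeries.coeff n) key
  rw [map_add, PowerSeries.coeff_C_mul, PowerSeries.coeff_mul, PowerSeries.coeff_mul] at this
  simpa only [PowerSeries.coeff_mk] using this

open Finset in
theorem norm_sum_range_sub_tsum_le {g : ℕ → ℂ} {M s : ℝ} (hs0 : 0 ≤ s) (hs : s < 1)
    (hg : ∀ k, ‖g k‖ ≤ M * s ^ k) (k : ℕ) :
    ‖∑ j ∈ range (k + 1), g j - ∑' j, g j‖ ≤ M / (1 - s) * s ^ k := by
  have hM : 0 ≤ M := by simpa using (norm_nonneg _).trans (hg 0)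
  have hsum : Summable fun k => M * s ^ k := (summable_geometric_of_lt_one hs0 hs).mul_left M
  have hgs : Summable g := hsum.of_norm_bounded hg
  rw [norm_sub_rev, ← hgs.sum_add_tsum_nat_add (k + 1), add_sub_cancel_left]
  have h1 : HasSum (fun j => M * s ^ (j + (k + 1))) (M * s ^ (k + 1) * (1 - s)⁻¹) := by
    have := (hasSum_geometric_of_lt_one hs0 hs).mul_left (M * s ^ (k + 1))
    refine this.congr_fun ?_
    intro j; ring
  refine (tsum_of_norm_bounded h1 fun j => hg _).trans ?_
  rw [pow_succ, div_eq_mul_inv]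
  have : 0 ≤ (1 - s)⁻¹ := inv_nonneg.2 (by linarith)
  have h2 : M * s ^ k * (1 - s)⁻¹ * s ≤ M * s ^ k * (1 - s)⁻¹ * 1 := by gcongr
  nlinarith

/-- Passing from `z` to `z - 1` gains a factor `1 / n`. Replacing `m` by `n` costs `(n / m) ^ (2 -
Re z)`, which is polynomial in `k` because `n / m ≤ k + 1`; geometric decay absorbs it later. The
case `m = 0` is separate, since the bound on `scaledMultichoose` starts at index `1`. -/
theorem exists_norm_multichoose_sub_one_bound {R : ℝ} {N : ℕ} (hN : R + 2 ≤ N) :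
    ∃ C : ℝ, 0 ≤ C ∧ ∀ z : ℂ, ‖z‖ ≤ R → ∀ n : ℕ, 1 ≤ n → ∀ k m : ℕ, k + m = n →
      ‖Ring.multichoose (z - 1) m * (n : ℂ) ^ (1 - z)‖ ≤ C / n * ((k : ℝ) + 1) ^ N := by
  obtain ⟨C, hC0, hC⟩ := exists_scaledMultichoose_bound (R + 1)
  refine ⟨max C 1, by positivity, fun z hz n hn k m hkm => ?_⟩
  have hn0 : (0 : ℝ) < n := by exact_mod_cast hn
  have hre : |z.re| ≤ R := (Complex.abs_re_le_norm z).trans hz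
  have hre' := abs_le.1 hre
  have hnk : (1 : ℝ) ≤ n := by exact_mod_cast hn
  have hk1 : (1 : ℝ) ≤ k + 1 := by linarith [(Nat.cast_nonneg k : (0 : ℝ) ≤ k)]
  have hnorm : ∀ w : ℂ, ‖(n : ℂ) ^ w‖ = (n : ℝ) ^ w.re := fun w =>
    Complex.norm_natCast_cpow_of_pos hn w
  rcases Nat.eq_zero_or_pos m with rfl | hm
  · have hkn : k = n := by omega
    subst hkn
    rw [Ring.multichoose_zero_right, one_mul, hnorm]
    have h1 : (k : ℝ) ^ (1 - z).re = (k : ℝ) ^ (2 - z.re) / k := by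
      rw [← Real.rpow_sub_one hn0.ne']; congr 1; simp; ring
    rw [h1]
    have h2 : (k : ℝ) ^ (2 - z.re) ≤ (k : ℝ) ^ N := by
      rw [← Real.rpow_natCast]
      exact Real.rpow_le_rpow_of_exponent_le hnk (by linarith)
    have h3 : (k : ℝ) ^ N ≤ ((k : ℝ) + 1) ^ N := by gcongr; linarith
    rw [div_mul_eq_mul_div]
    gcongr
    calc _ ≤ 1 * ((k : ℝ) + 1) ^ N := by rw [one_mul]; exact h2.trans h3
      _ ≤ _ := by gcongr; exact le_max_right _ _
  · have hm0 : (0 : ℝ) < m := by exact_mod_cast hm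
    have hz1 : ‖z - 1‖ ≤ R + 1 := (norm_sub_le _ _).trans (by simpa using hz)
    have h1 := (hC (z - 1) hz1 m hm).1
    unfold scaledMultichoose at h1
    rw [norm_mul, Complex.norm_natCast_cpow_of_pos hm] at h1
    rw [norm_mul, hnorm]
    have e1 : (1 - (z - 1)).re = 2 - z.re := by simp; ring
    rw [e1] at h1
    have h2 : ‖Ring.multichoose (z - 1) m‖ ≤ C / (m : ℝ) ^ (2 - z.re) := by
      rwa [le_div_iff₀ (Real.rpow_pos_of_pos hm0 _)]
    have h3 : (n : ℝ) ^ (1 - z).re = (n : ℝ) ^ (2 - z.re) / n := by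
      rw [← Real.rpow_sub_one hn0.ne']; congr 1; simp; ring
    have h4 : (n : ℝ) / m ≤ k + 1 := by
      rw [div_le_iff₀ hm0, ← hkm]
      push_cast
      have hm1 : (1 : ℝ) ≤ m := by exact_mod_cast hm
      nlinarith [(Nat.cast_nonneg k : (0 : ℝ) ≤ k)]
    have h5 : (1 : ℝ) ≤ (n : ℝ) / m := by
      rw [le_div_iff₀ hm0, one_mul]; exact_mod_cast (by omega : m ≤ n)
    have h6 : (n : ℝ) ^ (2 - z.re) / (m : ℝ) ^ (2 - z.re) ≤ ((k : ℝ) + 1) ^ N := by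
      rw [← Real.div_rpow hn0.le hm0.le]
      calc ((n : ℝ) / m) ^ (2 - z.re) ≤ ((n : ℝ) / m) ^ (N : ℝ) :=
            Real.rpow_le_rpow_of_exponent_le h5 (by linarith)
        _ = ((n : ℝ) / m) ^ N := Real.rpow_natCast _ _
        _ ≤ _ := by gcongr
    rw [h3]
    calc _ ≤ C / (m : ℝ) ^ (2 - z.re) * ((n : ℝ) ^ (2 - z.re) / n) := by gcongr
      _ = C / n * ((n : ℝ) ^ (2 - z.re) / (m : ℝ) ^ (2 - z.re)) := by ring
      _ ≤ max C 1 / n * ((k : ℝ) + 1) ^ N := by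
        gcongr
        exact le_max_left _ _

open Finset in
/-- If `g` decays geometrically, the coefficients of `(1 - u) ^ (-z) * ∑ g k u ^ k` are
`n ^ (z - 1) * ((∑ g k) / Γ(z) + O(1 / n))`, uniformly in `g` and in bounded `z`. -/
theorem exists_coeff_bound (R M : ℝ) {s : ℝ} (hs0 : 0 ≤ s) (hs : s < 1) :
    ∃ C : ℝ, ∀ z : ℂ, ‖z‖ ≤ R → ∀ g : ℕ → ℂ, (∀ k, ‖g k‖ ≤ M * s ^ k) → ∀ n : ℕ, 1 ≤ n →
      ‖(∑ p ∈ antidiagonal n, g p.1 * Ring.multichoose z p.2) * (n : ℂ) ^ (1 - z) -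
        (Complex.Gamma z)⁻¹ * ∑' k, g k‖ ≤ C / n := by
  obtain ⟨N, hN⟩ := exists_nat_ge (R + 2)
  obtain ⟨C₁, hC₁0, hC₁⟩ := exists_scaledMultichoose_bound R
  obtain ⟨C₂, hC₂0, hC₂⟩ := exists_norm_multichoose_sub_one_bound hN
  have hS : Summable fun k : ℕ => s ^ k * ((k : ℝ) + 1) ^ N := by
    have h := summable_pow_mul_geometric_of_norm_lt_one N (r := s)
      (by rwa [Real.norm_eq_abs, abs_of_nonneg hs0])
    rcases hs0.eq_or_lt with rfl | hs0
    · exact summable_of_ne_finset_zero (s := {0}) fun k hk => by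
        rw [zero_pow (by simpa using hk), zero_mul]
    · have h1 := ((summable_nat_add_iff 1).2 h).mul_left s⁻¹
      refine h1.congr fun k => ?_
      push_cast
      rw [pow_succ]; field_simp
  set S := ∑' k : ℕ, s ^ k * ((k : ℝ) + 1) ^ N with hSdef
  refine ⟨M / (1 - s) * C₁ + M / (1 - s) * C₂ * S, fun z hz g hg n hn => ?_⟩
  have hM : 0 ≤ M := by simpa using (norm_nonneg _).trans (hg 0)
  have hMs : 0 ≤ M / (1 - s) := div_nonneg hM (by linarith)
  set G := ∑' k, g k with hG
  have hGn : ‖G‖ ≤ M / (1 - s) := by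
    have h1 : HasSum (fun j => M * s ^ j) (M * (1 - s)⁻¹) :=
      (hasSum_geometric_of_lt_one hs0 hs).mul_left M
    exact tsum_of_norm_bounded h1 hg
  rw [sum_antidiagonal_mul_multichoose z G g n]
  have e : (G * Ring.multichoose z n + ∑ p ∈ antidiagonal n,
        (∑ j ∈ range (p.1 + 1), g j - G) * Ring.multichoose (z - 1) p.2) * (n : ℂ) ^ (1 - z) -
        (Complex.Gamma z)⁻¹ * G =
      G * (scaledMultichoose z n - (Complex.Gamma z)⁻¹) + ∑ p ∈ antidiagonal n,
        (∑ j ∈ range (p.1 + 1), g j - G) *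
          (Ring.multichoose (z - 1) p.2 * (n : ℂ) ^ (1 - z)) := by
    rw [add_mul, sum_mul, scaledMultichoose]
    simp_rw [mul_assoc]
    ring
  rw [e, add_div]
  refine (norm_add_le _ _).trans (add_le_add ?_ ?_)
  · rw [norm_mul, mul_div_assoc]
    gcongr
    exact (hC₁ z hz n hn).2
  · refine (norm_sum_le _ _).trans ?_
    calc _ ≤ ∑ p ∈ antidiagonal n, M / (1 - s) * C₂ / n * (s ^ p.1 * ((p.1 : ℝ) + 1) ^ N) := by
          refine sum_le_sum fun p hp => ?_
          rw [norm_mul]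
          calc _ ≤ M / (1 - s) * s ^ p.1 * (C₂ / n * ((p.1 : ℝ) + 1) ^ N) := by
                gcongr
                · exact norm_sum_range_sub_tsum_le hs0 hs hg _
                · exact hC₂ z hz n hn _ _ (mem_antidiagonal.1 hp)
            _ = _ := by ring
      _ = M / (1 - s) * C₂ / n * ∑ k ∈ range (n + 1), (s ^ k * ((k : ℝ) + 1) ^ N) := by
          rw [← mul_sum, Nat.sum_antidiagonal_eq_sum_range_succ_mk]
      _ ≤ M / (1 - s) * C₂ / n * S := by
          gcongr
          exact hS.sum_le_tsum _ fun k _ => by positivity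
      _ = _ := by ring

/-! ### Sieving a multiplicative sum over monic polynomials -/

open Polynomial in
/-- A function on polynomials that is completely multiplicative on the monic ones. -/
structure IsMonicMultiplicative {F : Type*} [Field F] (φ : F[X] → ℂ) : Prop where
  map_one : φ 1 = 1
  map_mul : ∀ f g : F[X], f.Monic → g.Monic → φ (f * g) = φ f * φ g

open Polynomial in
open scoped Classical in
theorem IsMonicMultiplicative.ite_not_dvd {F : Type*} [Field F] {φ : F[X] → ℂ}
    (hφ : IsMonicMultiplicative φ) {P : F[X]} (hP : Irreducible P) :
    IsMonicMultiplicative fun f => if P ∣ f then 0 else φ f where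
  map_one := by
    rw [if_neg (fun h => hP.not_isUnit (isUnit_of_dvd_one h)), hφ.map_one]
  map_mul f g hf hg := by
    by_cases h1 : P ∣ f
    · simp [h1, h1.mul_right g]
    · by_cases h2 : P ∣ g
      · simp [h2, h2.mul_left f]
      · have : ¬ P ∣ f * g := fun h => (hP.prime.dvd_or_dvd h).elim h1 h2
        simp [h1, h2, this, hφ.map_mul f g hf hg]

-- Multiplication by `P` maps the monic polynomials bijectively onto the monic multiples of `P`, so
-- `φ P` times the sum is the part carried by those multiples.
open Polynomial in
open scoped Classical in
theorem one_sub_mul_tsum_monic {F : Type*} [Field F] {φ : F[X] → ℂ}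
    (hφ : IsMonicMultiplicative φ) (hs : Summable fun f : {f : F[X] // f.Monic} => ‖φ f‖)
    {P : F[X]} (hPm : P.Monic) :
    (1 - φ P) * ∑' f : {f : F[X] // f.Monic}, φ f =
      ∑' f : {f : F[X] // f.Monic}, if P ∣ (f : F[X]) then 0 else φ f := by
  have hs1 : Summable fun f : {f : F[X] // f.Monic} => φ f := hs.of_norm
  let e : {f : F[X] // f.Monic} → {f : F[X] // f.Monic} := fun f => ⟨P * f, hPm.mul f.2⟩
  have he : Function.Injective e := fun f g h => by
    have : P * (f : F[X]) = P * g := congrArg Subtype.val h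
    exact Subtype.ext (mul_left_cancel₀ hPm.ne_zero this)
  have h0 : Summable fun f : {f : F[X] // f.Monic} => if P ∣ (f : F[X]) then 0 else φ f := by
    refine hs.of_norm_bounded fun f => ?_
    split_ifs <;> simp
  have h1 : Summable fun f : {f : F[X] // f.Monic} => if P ∣ (f : F[X]) then φ f else 0 := by
    refine hs.of_norm_bounded fun f => ?_
    split_ifs <;> simp
  have h2 : ∑' f : {f : F[X] // f.Monic}, (if P ∣ (f : F[X]) then φ f else 0) =
      φ P * ∑' f : {f : F[X] // f.Monic}, φ f := by
    rw [← he.tsum_eq, ← tsum_mul_left]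
    · refine tsum_congr fun f => ?_
      simp [e, hφ.map_mul P f hPm f.2]
    · intro f hf
      rw [Function.mem_support] at hf
      obtain ⟨g, hg⟩ : P ∣ (f : F[X]) := by
        by_contra h; simp [h] at hf
      have hgm : g.Monic := hPm.of_mul_monic_left (hg ▸ f.2)
      exact ⟨⟨g, hgm⟩, Subtype.ext hg.symm⟩
  rw [sub_mul, one_mul, ← h2, ← hs1.tsum_sub h1]
  refine tsum_congr fun f => ?_
  split_ifs <;> simp

-- The induction varies `φ`: after removing the multiples of one prime, the restricted function is
-- still multiplicative and keeps its values at the other primes.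
open Polynomial in
open scoped Classical in
theorem prod_one_sub_mul_tsum_monic {F ι : Type*} [Field F] {p : ι → F[X]}
    (hinj : Function.Injective p) (hm : ∀ i, (p i).Monic) (hirr : ∀ i, Irreducible (p i))
    (T : Finset ι) {φ : F[X] → ℂ}
    (hφ : IsMonicMultiplicative φ) (hs : Summable fun f : {f : F[X] // f.Monic} => ‖φ f‖) :
    (∏ i ∈ T, (1 - φ (p i))) * ∑' f : {f : F[X] // f.Monic}, φ f =
      ∑' f : {f : F[X] // f.Monic}, if ∃ i ∈ T, p i ∣ (f : F[X]) then 0 else φ f := by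
  induction T using Finset.induction_on generalizing φ with
  | empty => simp
  | insert i T hi ih =>
    have hs' : Summable fun f : {f : F[X] // f.Monic} =>
        ‖if p i ∣ (f : F[X]) then 0 else φ f‖ := by
      refine hs.of_nonneg_of_le (fun _ => norm_nonneg _) fun f => ?_
      split_ifs <;> simp
    have h := ih (hφ.ite_not_dvd (hirr i)) hs'
    rw [← one_sub_mul_tsum_monic hφ hs (hm i)] at h
    rw [Finset.prod_insert hi, mul_comm (1 - φ (p i)), mul_assoc]
    have h2 : ∏ j ∈ T, (1 - φ (p j)) = ∏ j ∈ T, (1 - if p i ∣ p j then 0 else φ (p j)) := by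
      refine Finset.prod_congr rfl fun j hj => ?_
      rw [if_neg]
      intro hd
      have : p i = p j :=
        eq_of_monic_of_associated (hm i) (hm j) ((hirr i).associated_of_dvd (hirr j) hd)
      exact hi (hinj this ▸ hj)
    rw [h2, h]
    refine tsum_congr fun f => ?_
    simp only [Finset.mem_insert, exists_eq_or_imp]
    by_cases h1 : p i ∣ (f : F[X]) <;> simp [h1]

-- As the sieving set grows, only `f = 1` survives; dominated convergence with majorant `‖φ‖`
-- applies. The hypothesis `hdvd` lets `p` list only the primes relevant to the support of `φ`.
open Polynomial Filter Topology in
theorem tendsto_prod_one_sub_mul_tsum_monic {F ι : Type*} [Field F] {p : ι → F[X]}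
    (hinj : Function.Injective p) (hm : ∀ i, (p i).Monic) (hirr : ∀ i, Irreducible (p i))
    {φ : F[X] → ℂ} (hφ : IsMonicMultiplicative φ)
    (hs : Summable fun f : {f : F[X] // f.Monic} => ‖φ f‖)
    (hdvd : ∀ f : F[X], f.Monic → f ≠ 1 → φ f ≠ 0 → ∃ i, p i ∣ f) :
    Tendsto (fun T : Finset ι => (∏ i ∈ T, (1 - φ (p i))) * ∑' f : {f : F[X] // f.Monic}, φ f)
      atTop (𝓝 1) := by
  classical
  simp_rw [prod_one_sub_mul_tsum_monic hinj hm hirr _ hφ hs]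
  have h1 : ∑' f : {f : F[X] // f.Monic}, (if (f : F[X]) = 1 then (1 : ℂ) else 0) = 1 := by
    rw [tsum_eq_single ⟨1, monic_one⟩]
    · simp
    · intro f hf
      rw [if_neg]
      exact fun h => hf (Subtype.ext h)
  rw [← h1]
  refine tendsto_tsum_of_dominated_convergence hs (fun f => ?_) (Eventually.of_forall fun T f => ?_)
  · by_cases hf : (f : F[X]) = 1
    · refine tendsto_const_nhds.congr fun T => ?_
      rw [if_pos hf, if_neg, hf, hφ.map_one]
      rintro ⟨i, -, hi⟩
      rw [hf] at hi
      exact (hirr i).not_isUnit (isUnit_of_dvd_one hi)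
    · rw [if_neg hf]
      by_cases h0 : φ f = 0
      · simp [h0]
      · obtain ⟨i, hi⟩ := hdvd f f.2 hf h0
        refine tendsto_const_nhds.congr' ?_
        filter_upwards [eventually_ge_atTop {i}] with T hT
        rw [if_pos ⟨i, hT (Finset.mem_singleton_self i), hi⟩]
  · split_ifs <;> simp

/-! ### Counting monic polynomials by degree -/

section counting
open Polynomial
variable (F : Type*) [Field F]

theorem natCard_monic_natDegree_eq (n : ℕ) :
    Nat.card {p : F[X] // p.Monic ∧ p.natDegree = n} = Nat.card F ^ n := by
  rw [Nat.card_congr ((monicEquivDegreeLT n).trans (degreeLTEquiv F n).toEquiv), Nat.card_fun]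
  simp

variable [Finite F]

instance finite_monic_natDegree_eq (n : ℕ) :
    Finite {p : F[X] // p.Monic ∧ p.natDegree = n} :=
  Finite.of_equiv _ ((monicEquivDegreeLT n).trans (degreeLTEquiv F n).toEquiv).symm

/-- Monic polynomials, sorted by degree. -/
def sigmaMonicEquiv :
    (Σ n : ℕ, {p : F[X] // p.Monic ∧ p.natDegree = n}) ≃ {f : F[X] // f.Monic} where
  toFun p := ⟨p.2.1, p.2.2.1⟩
  invFun f := ⟨f.1.natDegree, f.1, f.2, rfl⟩
  left_inv := by rintro ⟨n, p, hp, rfl⟩; rfl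
  right_inv f := rfl

theorem hasSum_monic_pow_natDegree {x : ℝ} (hx0 : 0 ≤ x) (hx : Nat.card F * x < 1) :
    HasSum (fun f : {f : F[X] // f.Monic} => x ^ f.1.natDegree) (1 - Nat.card F * x)⁻¹ := by
  rw [← (sigmaMonicEquiv F).hasSum_iff]
  have hfib : ∀ n : ℕ, HasSum (fun p : {p : F[X] // p.Monic ∧ p.natDegree = n} =>
      x ^ p.1.natDegree) ((Nat.card F * x) ^ n) := by
    intro n
    have := Fintype.ofFinite {p : F[X] // p.Monic ∧ p.natDegree = n}
    convert hasSum_fintype _ using 1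
    rw [Finset.sum_congr rfl fun p _ => by rw [p.2.2]]
    rw [Finset.sum_const, Finset.card_univ, ← Nat.card_eq_fintype_card,
      natCard_monic_natDegree_eq, nsmul_eq_mul, mul_pow]
    push_cast; rfl
  have hg := hasSum_geometric_of_lt_one (by positivity) hx
  have hsum : Summable ((fun f : {f : F[X] // f.Monic} => x ^ f.1.natDegree) ∘
      sigmaMonicEquiv F) := by
    refine (summable_sigma_of_nonneg fun p => by dsimp; positivity).2 ⟨fun n => (hfib n).summable, ?_⟩
    refine hg.summable.congr fun n => ?_
    exact (hfib n).tsum_eq.symm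
  have h := hsum.hasSum.sigma hfib
  exact (hg.unique h).symm ▸ hsum.hasSum

theorem hasSum_sum_natDegree {φ : F[X] → ℂ}
    (hs : Summable fun f : {f : F[X] // f.Monic} => ‖φ f‖) :
    HasSum (fun n : ℕ => ∑' p : {p : F[X] // p.Monic ∧ p.natDegree = n}, φ p)
      (∑' f : {f : F[X] // f.Monic}, φ f) := by
  have h := (sigmaMonicEquiv F).hasSum_iff.2 hs.of_norm.hasSum
  refine h.sigma fun n => ?_
  exact (summable_of_hasFiniteSupport (Set.toFinite _)).hasSum

end counting

/-! ### The weight `z ^ Ω(f) * t ^ deg f` on root-free polynomials -/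

section omega
open Polynomial
variable {F : Type*} [Field F]

theorem polyOmega_mul {f g : F[X]} (hf : f ≠ 0) (hg : g ≠ 0) :
    polyOmega (f * g) = polyOmega f + polyOmega g := by
  unfold polyOmega
  rw [← Multiset.card_add]
  exact Multiset.card_eq_card_of_rel (UniqueFactorizationMonoid.factors_mul hf hg)

theorem polyOmega_one : polyOmega (1 : F[X]) = 0 := by
  simp [polyOmega]

theorem polyOmega_irreducible {f : F[X]} (hf : Irreducible f) : polyOmega f = 1 := by
  rw [polyOmega, UniqueFactorizationMonoid.card_factors_of_irreducible hf]

theorem polyOmega_le_natDegree {f : F[X]} (hf : f ≠ 0) : polyOmega f ≤ f.natDegree := by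
  have h := UniqueFactorizationMonoid.factors_prod hf
  have h0 : (0 : F[X]) ∉ UniqueFactorizationMonoid.factors f := fun h =>
    (UniqueFactorizationMonoid.irreducible_of_factor _ h).ne_zero rfl
  rw [← natDegree_eq_of_degree_eq (degree_eq_degree_of_associated h),
    natDegree_multiset_prod _ h0, polyOmega]
  have := Multiset.card_nsmul_le_sum
    (s := (UniqueFactorizationMonoid.factors f).map natDegree) (a := 1) (fun x hx => by
      obtain ⟨p, hp, rfl⟩ := Multiset.mem_map.1 hx
      exact (UniqueFactorizationMonoid.irreducible_of_factor _ hp).natDegree_pos)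
  simpa using this

open scoped Classical in
/-- The summand `z ^ Ω(f) * t ^ deg f`, restricted to polynomials without roots. -/
noncomputable def rootFreeWeight (z t : ℂ) (f : F[X]) : ℂ :=
  if ∃ a, f.IsRoot a then 0 else z ^ polyOmega f * t ^ f.natDegree

theorem isMonicMultiplicative_rootFreeWeight (z t : ℂ) :
    IsMonicMultiplicative (rootFreeWeight (F := F) z t) where
  map_one := by simp [rootFreeWeight, polyOmega_one]
  map_mul f g hf hg := by
    unfold rootFreeWeight
    by_cases h1 : ∃ a, f.IsRoot a
    · have : ∃ a, (f * g).IsRoot a := h1.imp fun a ha => root_mul.2 (Or.inl ha)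
      rw [if_pos h1, if_pos this, zero_mul]
    · by_cases h2 : ∃ a, g.IsRoot a
      · have : ∃ a, (f * g).IsRoot a := h2.imp fun a ha => root_mul.2 (Or.inr ha)
        rw [if_pos h2, if_pos this, mul_zero]
      · have : ¬ ∃ a, (f * g).IsRoot a := by
          rintro ⟨a, ha⟩
          rcases root_mul.1 ha with h | h
          exacts [h1 ⟨a, h⟩, h2 ⟨a, h⟩]
        rw [if_neg h1, if_neg h2, if_neg this, polyOmega_mul hf.ne_zero hg.ne_zero,
          hf.natDegree_mul hg]
        ring

theorem norm_rootFreeWeight_le (z t : ℂ) {f : F[X]} (hf : f ≠ 0) :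
    ‖rootFreeWeight z t f‖ ≤ (max 1 ‖z‖ * ‖t‖) ^ f.natDegree := by
  unfold rootFreeWeight
  split_ifs
  · rw [norm_zero]; positivity
  · rw [norm_mul, norm_pow, norm_pow, mul_pow]
    gcongr
    calc ‖z‖ ^ polyOmega f ≤ max 1 ‖z‖ ^ polyOmega f := by gcongr; exact le_max_right _ _
      _ ≤ _ := pow_le_pow_right₀ (le_max_left _ _) (polyOmega_le_natDegree hf)

theorem PrimesGeTwo.not_isRoot (P : PrimesGeTwo F) (a : F) : ¬ P.1.IsRoot a := by
  intro h
  have := degree_eq_one_of_irreducible_of_root P.2.2.1 h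
  have h2 := P.2.2.2
  rw [natDegree_eq_of_degree_eq_some (n := 1) this] at h2
  omega

theorem rootFreeWeight_prime (z t : ℂ) (P : PrimesGeTwo F) :
    rootFreeWeight z t P.1 = z * t ^ P.1.natDegree := by
  rw [rootFreeWeight, if_neg (by rintro ⟨a, ha⟩; exact P.not_isRoot a ha),
    polyOmega_irreducible P.2.2.1, pow_one]

theorem exists_primesGeTwo_dvd {f : F[X]} (hf : f.Monic) (hf1 : f ≠ 1)
    (hr : ∀ a, ¬ f.IsRoot a) : ∃ P : PrimesGeTwo F, P.1 ∣ f := by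
  obtain ⟨g, hgm, hg, hgf⟩ := exists_monic_irreducible_factor f
    (fun h => hf1 (hf.eq_one_of_isUnit h))
  refine ⟨⟨g, hgm, hg, ?_⟩, hgf⟩
  by_contra h
  have h1 : g.natDegree = 1 := by have := hg.natDegree_pos; omega
  obtain ⟨a, ha⟩ := exists_root_of_degree_eq_one (by
    rw [degree_eq_natDegree hg.ne_zero, h1]; rfl : g.degree = 1)
  exact hr a (ha.dvd hgf)

end omega

/-! ### Euler product of the generating function -/

section euler
open Polynomial Filter Topology
variable (F : Type*) [Field F] [Finite F]

theorem summable_norm_rootFreeWeight {z t : ℂ} (h : Nat.card F * (max 1 ‖z‖ * ‖t‖) < 1) :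
    Summable fun f : {f : F[X] // f.Monic} => ‖rootFreeWeight z t f.1‖ :=
  (hasSum_monic_pow_natDegree F (by positivity) h).summable.of_nonneg_of_le
    (fun _ => norm_nonneg _) fun f => norm_rootFreeWeight_le z t f.2.ne_zero

theorem tsum_rootFreeWeight_natDegree (z t : ℂ) (n : ℕ) :
    ∑' p : {p : F[X] // p.Monic ∧ p.natDegree = n}, rootFreeWeight z t p.1 =
      rootFreeSum F n z * t ^ n := by
  classical
  have := Fintype.ofFinite {p : F[X] // p.Monic ∧ p.natDegree = n}
  rw [tsum_fintype, rootFreeSum, Finset.sum_mul]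
  symm
  refine Finset.sum_bij_ne_zero
    (fun f hf _ => ⟨f, ((Set.Finite.mem_toFinset _).1 hf).1, ((Set.Finite.mem_toFinset _).1 hf).2.1⟩)
    (fun _ _ _ => Finset.mem_univ _) (fun f _ _ g _ _ h => congrArg Subtype.val h) ?_ ?_
  · rintro ⟨f, hf, hn⟩ - hne
    have hr : ¬ ∃ a, f.IsRoot a := fun h => hne (if_pos h)
    refine ⟨f, (Set.Finite.mem_toFinset _).2 ⟨hf, hn, fun a ha => hr ⟨a, ha⟩⟩, ?_, rfl⟩
    rw [rootFreeWeight, if_neg hr] at hne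
    simpa [hn] using hne
  · intro f hf _
    obtain ⟨-, h2, h3⟩ := (Set.Finite.mem_toFinset _).1 hf
    simp only [rootFreeWeight]
    rw [if_neg (by rintro ⟨a, ha⟩; exact h3 a ha), h2]

/-- The Euler product for the generating function of the sums `rootFreeSum F n z`. -/
theorem exists_hasSum_rootFreeSum {z t : ℂ} (h : Nat.card F * (max 1 ‖z‖ * ‖t‖) < 1) :
    ∃ A : ℂ, HasSum (fun n => rootFreeSum F n z * t ^ n) A ∧
      Tendsto (fun T : Finset (PrimesGeTwo F) =>
        (∏ P ∈ T, (1 - z * t ^ P.1.natDegree)) * A) atTop (𝓝 1) := by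
  refine ⟨∑' f : {f : F[X] // f.Monic}, rootFreeWeight z t f.1, ?_, ?_⟩
  · have := hasSum_sum_natDegree F (summable_norm_rootFreeWeight F h)
    simpa only [tsum_rootFreeWeight_natDegree] using this
  · have := tendsto_prod_one_sub_mul_tsum_monic (p := fun P : PrimesGeTwo F => P.1)
      Subtype.val_injective (fun P => P.2.1) (fun P => P.2.2.1)
      (isMonicMultiplicative_rootFreeWeight z t) (summable_norm_rootFreeWeight F h) ?_
    · simpa only [rootFreeWeight_prime] using this
    · intro f hf hf1 hne
      refine exists_primesGeTwo_dvd hf hf1 fun a ha => hne ?_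
      rw [rootFreeWeight, if_pos ⟨a, ha⟩]

/-- Having no root means being divisible by no `X - C a`, so sieving `1 / (1 - q t)` by these `q`
linear primes gives a closed form. -/
theorem hasSum_rootFreeSum_one {t : ℝ} (ht0 : 0 ≤ t) (ht : Nat.card F * t < 1) :
    HasSum (fun n => rootFreeSum F n 1 * (t : ℂ) ^ n)
      ((1 - t) ^ Nat.card F / (1 - Nat.card F * t)) := by
  classical
  have := Fintype.ofFinite F
  have hn : ‖(t : ℂ)‖ = t := by simp [abs_of_nonneg ht0]
  have h1 : Nat.card F * (max 1 ‖(1 : ℂ)‖ * ‖(t : ℂ)‖) < 1 := by simpa [hn, abs_of_nonneg ht0] using ht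
  have h2 := hasSum_sum_natDegree F (summable_norm_rootFreeWeight F h1)
  simp only [tsum_rootFreeWeight_natDegree] at h2
  convert h2 using 1
  have h3 := hasSum_monic_pow_natDegree F ht0 ht
  have hφ : IsMonicMultiplicative (fun f : F[X] => (t : ℂ) ^ f.natDegree) :=
    ⟨by simp, fun f g hf hg => by rw [hf.natDegree_mul hg, pow_add]⟩
  have h4 := prod_one_sub_mul_tsum_monic (p := fun a : F => X - C a)
    (fun a b h => by simpa using h) (fun a => monic_X_sub_C a) (fun a => irreducible_X_sub_C a)
    Finset.univ hφ (by simpa [hn, abs_of_nonneg ht0] using h3.summable)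
  have h5 : HasSum (fun f : {f : F[X] // f.Monic} => (t : ℂ) ^ f.1.natDegree)
      ((1 - Nat.card F * t)⁻¹) := by
    have := (Complex.hasSum_ofReal).2 h3
    push_cast at this
    exact this
  rw [h5.tsum_eq] at h4
  simp only [natDegree_X_sub_C, pow_one, Finset.prod_const, Finset.card_univ] at h4
  rw [Nat.card_eq_fintype_card] at h4 ⊢
  rw [div_eq_mul_inv, h4]
  refine tsum_congr fun f => ?_
  simp [rootFreeWeight, dvd_iff_isRoot]

end euler

/-! ### Local factors and the regular part -/

/-- The Euler factor as a function of `v = (u / q) ^ deg P`. -/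
noncomputable def localFactor (z v : ℂ) : ℂ := (1 - z * v)⁻¹ * (1 - v) ^ z

theorem one_sub_mem_slitPlane {v : ℂ} (hv : ‖v‖ < 1) : 1 - v ∈ Complex.slitPlane := by
  rw [sub_eq_add_neg]
  exact Complex.mem_slitPlane_of_norm_lt_one (by rwa [norm_neg])

theorem one_sub_ne_zero_of_norm_lt {v : ℂ} (hv : ‖v‖ < 1) : 1 - v ≠ 0 :=
  Complex.slitPlane_ne_zero (one_sub_mem_slitPlane hv)

/-- `(1 - v) ^ z` and `1 - z v` agree to first order in `v`; the bound `ρ` keeps the denominator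
away from zero. -/
theorem norm_localFactor_sub_one_le {R ρ : ℝ} {z v : ℂ} (hz : ‖z‖ ≤ R) (hv : ‖v‖ ≤ 1 / 2)
    (hzv : ‖z * v‖ ≤ ρ) (hρ : ρ < 1) :
    ‖localFactor z v - 1‖ ≤ (4 * R ^ 2 * Real.exp (2 * R) + R) / (1 - ρ) * ‖v‖ ^ 2 := by
  have h1 : ‖Complex.log (1 - v) - -v‖ ≤ ‖-v‖ ^ 2 := by
    rw [sub_eq_add_neg 1 v]
    refine (Complex.norm_log_one_add_sub_self_le (by rw [norm_neg]; linarith)).trans ?_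
    rw [norm_neg]
    have : (1 - ‖v‖)⁻¹ ≤ 2 := by
      rw [inv_le_comm₀ (by linarith) (by norm_num)]; linarith
    nlinarith [sq_nonneg ‖v‖]
  have h2 := norm_exp_mul_sub_one_sub_le hz (by rw [norm_neg]; linarith) h1
  rw [norm_neg] at h2
  have h3 : 1 - v ≠ 0 := one_sub_ne_zero_of_norm_lt (by linarith)
  have h4 : 1 - z * v ≠ 0 := one_sub_ne_zero_of_norm_lt (hzv.trans_lt hρ)
  have h5 : 1 - ρ ≤ ‖1 - z * v‖ := by
    have := norm_sub_norm_le (1 : ℂ) (z * v)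
    rw [norm_one] at this
    linarith
  have h6 : localFactor z v - 1 =
      (1 - z * v)⁻¹ * (Complex.exp (z * Complex.log (1 - v)) - 1 - z * -v) := by
    rw [localFactor, Complex.cpow_def_of_ne_zero h3, mul_comm (Complex.log _)]
    field_simp
    ring
  rw [h6, norm_mul, norm_inv, div_mul_eq_mul_div, ← div_eq_inv_mul]
  exact div_le_div₀ ((norm_nonneg _).trans h2) h2 (by linarith) h5

theorem norm_hasProd_le {ι : Type*} {f : ι → ℂ} {a : ℂ} {b : ι → ℝ} (hb : Summable b)
    (hf : ∀ i, ‖f i - 1‖ ≤ b i) (ha : HasProd f a) : ‖a‖ ≤ Real.exp (∑' i, b i) := by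
  refine le_of_tendsto ha.norm (Filter.Eventually.of_forall fun T => ?_)
  have h1 := Finset.norm_prod_one_add_sub_one_le T (fun i => f i - 1)
  simp only [add_sub_cancel] at h1
  have h2 := norm_add_le (∏ i ∈ T, f i - 1) 1
  rw [sub_add_cancel, norm_one] at h2
  have h3 : ∑ i ∈ T, ‖f i - 1‖ ≤ ∑' i, b i :=
    (Finset.sum_le_sum fun i _ => hf i).trans
      (hb.sum_le_tsum _ fun i _ => (norm_nonneg _).trans (hf i))
  have h4 := Real.exp_le_exp.2 h3
  refine (norm_prod T f).symm.trans_le ?_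
  linarith

theorem eulerFactor_eq_localFactor {F : Type*} [Field F] (z : ℂ) (P : PrimesGeTwo F) :
    eulerFactor F z P = localFactor z ((1 / Nat.card F) ^ P.1.natDegree) := by
  rw [eulerFactor, localFactor, one_div_pow, mul_one_div]

theorem norm_div_natCard_le (F : Type*) {r : ℝ} {u : ℂ} (hu : ‖u‖ ≤ r) :
    ‖u / Nat.card F‖ ≤ r / Nat.card F := by
  rw [norm_div, Complex.norm_natCast]; gcongr

section
open Filter Topology
variable (F : Type*) [Field F] [Finite F]

theorem two_le_natCard : (2 : ℝ) ≤ Nat.card F := by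
  exact_mod_cast Finite.one_lt_card (α := F)

theorem summable_pow_natDegree_primes {x : ℝ} (hx0 : 0 ≤ x) (hx : Nat.card F * x < 1) :
    Summable fun P : PrimesGeTwo F => x ^ P.1.natDegree := by
  have h := (hasSum_monic_pow_natDegree F hx0 hx).summable
  exact h.comp_injective (i := fun P : PrimesGeTwo F => (⟨P.1, P.2.1⟩ : {f : Polynomial F // f.Monic}))
    fun P Q h => by
      have h' : P.1 = Q.1 := congrArg (fun f : {f : Polynomial F // f.Monic} => f.1) h
      exact Subtype.ext h'

theorem norm_div_natCard_pow_le {r : ℝ} (hr : r ^ 2 < Nat.card F) {u : ℂ} (hu : ‖u‖ ≤ r) {d : ℕ}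
    (hd : 2 ≤ d) : ‖(u / Nat.card F) ^ d‖ ≤ r ^ 2 / (Nat.card F : ℝ) ^ 2 := by
  have hq := two_le_natCard F
  have hr0 : 0 ≤ r := (norm_nonneg u).trans hu
  have h1 : r / Nat.card F ≤ 1 := by
    rw [div_le_one (by linarith)]; nlinarith
  rw [norm_pow, norm_div, Complex.norm_natCast, ← div_pow]
  calc (‖u‖ / Nat.card F) ^ d ≤ (r / Nat.card F) ^ d := by gcongr
    _ ≤ _ := pow_le_pow_of_le_one (by positivity) h1 hd

theorem sq_div_sq_le_half {r : ℝ} (hr : r ^ 2 < Nat.card F) :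
    r ^ 2 / (Nat.card F : ℝ) ^ 2 ≤ 1 / 2 := by
  have hq := two_le_natCard F
  rw [div_le_div_iff₀ (by positivity) (by norm_num)]
  nlinarith

/-- The regular part of the generating function, in the variable `u = q * t`. -/
noncomputable def regularPart (z u : ℂ) : ℂ :=
  (1 - u / (Nat.card F : ℂ)) ^ ((Nat.card F : ℂ) * z) *
    ∏' P : PrimesGeTwo F, localFactor z ((u / Nat.card F) ^ P.1.natDegree)

/-- The constant in the uniform bound for the Euler factors. -/
noncomputable def factorConst (R r : ℝ) : ℝ :=
  (4 * R ^ 2 * Real.exp (2 * R) + R) / (1 - R * (r ^ 2 / (Nat.card F : ℝ) ^ 2))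

variable {F} in
theorem norm_mul_pow_le {R r : ℝ} (hr : r ^ 2 < Nat.card F)
    {z u : ℂ} (hz : ‖z‖ ≤ R) (hu : ‖u‖ ≤ r) (P : PrimesGeTwo F) :
    ‖z * (u / Nat.card F) ^ P.1.natDegree‖ ≤ R * (r ^ 2 / (Nat.card F : ℝ) ^ 2) := by
  have hR : 0 ≤ R := (norm_nonneg z).trans hz
  rw [norm_mul]
  gcongr
  exact norm_div_natCard_pow_le F hr hu P.2.2.2

theorem mul_sq_div_sq_lt_one {R r : ℝ} (hRr : R * r ^ 2 < (Nat.card F : ℝ) ^ 2) :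
    R * (r ^ 2 / (Nat.card F : ℝ) ^ 2) < 1 := by
  have hq := two_le_natCard F
  rw [← mul_div_assoc, div_lt_one (by positivity)]
  exact hRr

-- The quadratic gain makes the majorant geometric with ratio `r ^ 2 / q ^ 2`, summable over all
-- primes once `r ^ 2 < q`. That leaves room for `r > 1`.
variable {F} in
theorem norm_localFactor_pow_sub_one_le {R r : ℝ} (hr : r ^ 2 < Nat.card F)
    (hRr : R * r ^ 2 < (Nat.card F : ℝ) ^ 2) {z u : ℂ} (hz : ‖z‖ ≤ R) (hu : ‖u‖ ≤ r)
    (P : PrimesGeTwo F) :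
    ‖localFactor z ((u / Nat.card F) ^ P.1.natDegree) - 1‖ ≤
      factorConst F R r * (r ^ 2 / (Nat.card F : ℝ) ^ 2) ^ P.1.natDegree := by
  have hR : 0 ≤ R := (norm_nonneg z).trans hz
  have hρ := mul_sq_div_sq_lt_one F hRr
  refine (norm_localFactor_sub_one_le hz
    ((norm_div_natCard_pow_le F hr hu P.2.2.2).trans (sq_div_sq_le_half F hr))
    (norm_mul_pow_le hr hz hu P) hρ).trans ?_
  unfold factorConst
  have : 0 ≤ 1 - R * (r ^ 2 / (Nat.card F : ℝ) ^ 2) := by linarith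
  gcongr
  rw [norm_pow, norm_div, Complex.norm_natCast, ← pow_mul, mul_comm, pow_mul, div_pow]
  gcongr

theorem summable_factor_bound {R r : ℝ} (hr : r ^ 2 < Nat.card F) :
    Summable fun P : PrimesGeTwo F =>
      factorConst F R r * (r ^ 2 / (Nat.card F : ℝ) ^ 2) ^ P.1.natDegree := by
  have hq := two_le_natCard F
  refine (summable_pow_natDegree_primes F (by positivity) ?_).mul_left _
  have : (Nat.card F : ℝ) * (r ^ 2 / (Nat.card F : ℝ) ^ 2) = r ^ 2 / Nat.card F := by
    field_simp
  rw [this, div_lt_one (by linarith)]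
  exact hr

theorem multipliable_localFactor {R r : ℝ} (hr : r ^ 2 < Nat.card F)
    (hRr : R * r ^ 2 < (Nat.card F : ℝ) ^ 2) {z u : ℂ} (hz : ‖z‖ ≤ R) (hu : ‖u‖ ≤ r) :
    Multipliable fun P : PrimesGeTwo F => localFactor z ((u / Nat.card F) ^ P.1.natDegree) := by
  have h := multipliable_one_add_of_summable
    (f := fun P : PrimesGeTwo F => localFactor z ((u / Nat.card F) ^ P.1.natDegree) - 1)
    ((summable_factor_bound F (R := R) hr).of_nonneg_of_le (fun _ => norm_nonneg _)
      (norm_localFactor_pow_sub_one_le hr hRr hz hu))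
  simpa only [add_sub_cancel] using h

theorem differentiableOn_tprod_of_norm_sub_one_le {ι : Type*} {f : ι → ℂ → ℂ} {s : Set ℂ}
    (hs : IsOpen s) {b : ι → ℝ} (hb : Summable b) (hf : ∀ i, DifferentiableOn ℂ (f i) s)
    (hfb : ∀ i, ∀ x ∈ s, ‖f i x - 1‖ ≤ b i) : DifferentiableOn ℂ (fun x => ∏' i, f i x) s := by
  have h := hb.hasProdLocallyUniformlyOn_one_add (f := fun i x => f i x - 1) hs
    (Eventually.of_forall hfb) (fun i => (hf i).continuousOn.sub continuousOn_const)
  simp only [add_sub_cancel] at h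
  rw [hasProdLocallyUniformlyOn_iff_tendstoLocallyUniformlyOn] at h
  exact h.differentiableOn (Eventually.of_forall fun T => DifferentiableOn.fun_finsetProd
    fun i _ => hf i) hs

theorem differentiableAt_localFactor_left {z v : ℂ} (hv : ‖v‖ < 1) (hzv : ‖z * v‖ < 1) :
    DifferentiableAt ℂ (fun z => localFactor z v) z := by
  unfold localFactor
  refine DifferentiableAt.mul (DifferentiableAt.inv (by fun_prop) (one_sub_ne_zero_of_norm_lt hzv)) ?_
  exact DifferentiableAt.const_cpow differentiableAt_id (Or.inl (one_sub_ne_zero_of_norm_lt hv))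

theorem differentiableAt_localFactor_right {z v : ℂ} (hv : ‖v‖ < 1) (hzv : ‖z * v‖ < 1) :
    DifferentiableAt ℂ (localFactor z) v := by
  unfold localFactor
  refine DifferentiableAt.mul (DifferentiableAt.inv (by fun_prop) (one_sub_ne_zero_of_norm_lt hzv)) ?_
  exact DifferentiableAt.cpow_const (by fun_prop) (one_sub_mem_slitPlane hv)

theorem multipliable_eulerFactor {z : ℂ} (hz : ‖z‖ < (Nat.card F : ℝ) ^ 2) :
    Multipliable (eulerFactor F z) := by
  have hq := two_le_natCard F
  -- The product in `h` is that of `regularPart` at `u = 1`.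
  have := multipliable_localFactor F (R := ‖z‖) (r := 1) (z := z) (u := 1) (by linarith)
    (by linarith) le_rfl (by simp)
  exact this.congr fun P => (eulerFactor_eq_localFactor z P).symm

theorem analyticOnNhd_hFun :
    AnalyticOnNhd ℂ (hFun F) (Metric.ball 0 ((Nat.card F : ℝ) ^ 2)) := by
  have hq := two_le_natCard F
  intro z₀ hz₀
  rw [mem_ball_zero_iff] at hz₀
  obtain ⟨R, hR1, hR2⟩ := exists_between hz₀
  have hprod : DifferentiableOn ℂ (fun z => ∏' P : PrimesGeTwo F, eulerFactor F z P)
      (Metric.ball 0 R) := by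
    have hr : (1 : ℝ) ^ 2 < Nat.card F := by linarith
    have hRr : R * 1 ^ 2 < (Nat.card F : ℝ) ^ 2 := by linarith
    refine differentiableOn_tprod_of_norm_sub_one_le Metric.isOpen_ball
      (summable_factor_bound F (R := R) hr) (fun P z hz => ?_) (fun P z hz => ?_)
    · rw [mem_ball_zero_iff] at hz
      simp_rw [eulerFactor_eq_localFactor]
      refine (differentiableAt_localFactor_left ?_ ?_).differentiableWithinAt
      · have := (norm_div_natCard_pow_le F (u := 1) hr (by simp) P.2.2.2).trans
          (sq_div_sq_le_half F hr)
        linarith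
      · exact (norm_mul_pow_le hr hz.le (by simp) P).trans_lt (mul_sq_div_sq_lt_one F hRr)
    · rw [mem_ball_zero_iff] at hz
      rw [eulerFactor_eq_localFactor]
      exact norm_localFactor_pow_sub_one_le hr hRr hz.le (by simp) P
  have hq0 : (1 : ℂ) - 1 / (Nat.card F : ℂ) ≠ 0 := by
    refine one_sub_ne_zero_of_norm_lt ?_
    rw [norm_div, norm_one, Complex.norm_natCast, div_lt_one (by linarith)]
    linarith
  have hdiff : DifferentiableOn ℂ (hFun F) (Metric.ball 0 R) := by
    unfold hFun
    refine DifferentiableOn.mul (DifferentiableOn.mul ?_ ?_) hprod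
    · simp_rw [one_div]
      exact (Complex.differentiable_one_div_Gamma.comp
        (differentiable_id.add_const (1 : ℂ))).differentiableOn
    · exact fun z _ => (DifferentiableAt.const_cpow (by fun_prop) (Or.inl hq0)).differentiableWithinAt
  exact hdiff.analyticAt (Metric.isOpen_ball.mem_nhds (mem_ball_zero_iff.2 hR1))

theorem div_natCard_lt_one {r : ℝ} (hr : r ^ 2 < Nat.card F) : r / Nat.card F < 1 := by
  have hq := two_le_natCard F
  rw [div_lt_one (by linarith)]
  nlinarith

theorem differentiableOn_regularPart {R r : ℝ} (hr : r ^ 2 < Nat.card F)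
    (hRr : R * r ^ 2 < (Nat.card F : ℝ) ^ 2) {z : ℂ} (hz : ‖z‖ ≤ R) :
    DifferentiableOn ℂ (regularPart F z) (Metric.ball 0 r) := by
  unfold regularPart
  refine DifferentiableOn.mul (fun u hu => ?_) ?_
  · rw [mem_ball_zero_iff] at hu
    have hd : DifferentiableAt ℂ (fun u : ℂ => 1 - u / (Nat.card F : ℂ)) u := by fun_prop
    refine (hd.cpow_const (one_sub_mem_slitPlane ?_)).differentiableWithinAt
    exact (norm_div_natCard_le F hu.le).trans_lt (div_natCard_lt_one F hr)
  · refine differentiableOn_tprod_of_norm_sub_one_le Metric.isOpen_ball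
      (summable_factor_bound F (R := R) hr) (fun P u hu => ?_) (fun P u hu => ?_)
    · rw [mem_ball_zero_iff] at hu
      refine DifferentiableAt.differentiableWithinAt ?_
      have hd : DifferentiableAt ℂ (fun u : ℂ => (u / Nat.card F) ^ P.1.natDegree) u := by fun_prop
      refine DifferentiableAt.comp u (differentiableAt_localFactor_right ?_ ?_) hd
      · have := (norm_div_natCard_pow_le F hr hu.le P.2.2.2).trans (sq_div_sq_le_half F hr)
        linarith
      · exact (norm_mul_pow_le hr hz hu.le P).trans_lt (mul_sq_div_sq_lt_one F hRr)
    · rw [mem_ball_zero_iff] at hu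
      exact norm_localFactor_pow_sub_one_le hr hRr hz hu.le P

theorem exists_norm_regularPart_le {R r : ℝ} (hr : r ^ 2 < Nat.card F)
    (hRr : R * r ^ 2 < (Nat.card F : ℝ) ^ 2) :
    ∃ M : ℝ, ∀ z u : ℂ, ‖z‖ ≤ R → ‖u‖ ≤ r → ‖regularPart F z u‖ ≤ M := by
  have hq := two_le_natCard F
  set c := r / Nat.card F with hc
  have hc1 : c < 1 := div_natCard_lt_one F hr
  refine ⟨Real.exp ((c ^ 2 * (1 - c)⁻¹ / 2 + c) * (Nat.card F * R)) *
    Real.exp (∑' P : PrimesGeTwo F,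
      factorConst F R r * (r ^ 2 / (Nat.card F : ℝ) ^ 2) ^ P.1.natDegree), fun z u hz hu => ?_⟩
  have hcu : ‖u / Nat.card F‖ ≤ c := norm_div_natCard_le F hu
  have hc0 : 0 ≤ c := (norm_nonneg _).trans hcu
  rw [regularPart, norm_mul]
  gcongr
  · rw [Complex.cpow_def_of_ne_zero (one_sub_ne_zero_of_norm_lt (hcu.trans_lt hc1))]
    refine (Complex.norm_exp_le_exp_norm _).trans (Real.exp_le_exp.2 ?_)
    rw [norm_mul, norm_mul, Complex.norm_natCast]
    have h1 : ‖Complex.log (1 - u / Nat.card F)‖ ≤ c ^ 2 * (1 - c)⁻¹ / 2 + c := by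
      rw [sub_eq_add_neg]
      refine (Complex.norm_log_one_add_le (by rw [norm_neg]; exact hcu.trans_lt hc1)).trans ?_
      rw [norm_neg]
      have h3 : 0 < 1 - c := by linarith
      have h4 : (1 - ‖u / (Nat.card F : ℂ)‖)⁻¹ ≤ (1 - c)⁻¹ := inv_anti₀ h3 (by linarith)
      have h5 : 0 ≤ (1 - ‖u / (Nat.card F : ℂ)‖)⁻¹ := inv_nonneg.2 (by linarith)
      gcongr
    have h2 : 0 ≤ c ^ 2 * (1 - c)⁻¹ / 2 + c := (norm_nonneg _).trans h1
    gcongr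
  · exact norm_hasProd_le (summable_factor_bound F hr)
      (norm_localFactor_pow_sub_one_le hr hRr hz hu) (multipliable_localFactor F hr hRr hz hu).hasProd

theorem exists_taylor_regularPart {R : ℝ} (hR : R < (Nat.card F : ℝ) ^ 2) :
    ∃ M s : ℝ, 0 ≤ s ∧ s < 1 ∧ ∀ z : ℂ, ‖z‖ ≤ R → ∃ g : ℕ → ℂ, (∀ k, ‖g k‖ ≤ M * s ^ k) ∧
      ∀ u : ℂ, ‖u‖ ≤ 1 → HasSum (fun k => g k * u ^ k) (regularPart F z u) := by
  have hq := two_le_natCard F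
  -- Both inequalities are open conditions that hold at `r = 1`, hence slightly beyond it.
  obtain ⟨r, ⟨hr, hRr⟩, hr1⟩ : ∃ r : ℝ, (r ^ 2 < Nat.card F ∧ R * r ^ 2 < (Nat.card F : ℝ) ^ 2) ∧
      1 < r := by
    have h1 : ∀ᶠ r : ℝ in 𝓝 1, r ^ 2 < Nat.card F :=
      (by fun_prop : Continuous fun r : ℝ => r ^ 2).continuousAt.eventually_lt_const (by linarith)
    have h2 : ∀ᶠ r : ℝ in 𝓝 1, R * r ^ 2 < (Nat.card F : ℝ) ^ 2 :=
      (by fun_prop : Continuous fun r : ℝ => R * r ^ 2).continuousAt.eventually_lt_const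
        (by linarith)
    exact (((h1.and h2).filter_mono nhdsWithin_le_nhds).and
      (self_mem_nhdsWithin : Set.Ioi (1 : ℝ) ∈ 𝓝[>] 1)).exists
  -- Cauchy's estimate is applied on the circle of radius `r'`, inside the open disc of analyticity;
  -- it gives the decay rate `s = 1 / r'`.
  obtain ⟨r', hr'1, hr'r⟩ := exists_between hr1
  have hr'0 : 0 < r' := by linarith
  obtain ⟨M, hM⟩ := exists_norm_regularPart_le F hr hRr
  refine ⟨M, r'⁻¹, by positivity, inv_lt_one_of_one_lt₀ hr'1, fun z hz =>
    ⟨fun k => (k.factorial : ℂ)⁻¹ * iteratedDeriv k (regularPart F z) 0, fun k => ?_,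
      fun u hu => ?_⟩⟩
  · have hd : DiffContOnCl ℂ (regularPart F z) (Metric.ball 0 r') := by
      refine DifferentiableOn.diffContOnCl ((differentiableOn_regularPart F hr hRr hz).mono ?_)
      rw [closure_ball _ hr'0.ne']
      exact Metric.closedBall_subset_ball hr'r
    have h1 := Complex.norm_iteratedDeriv_le_of_forall_mem_sphere_norm_le k hr'0 hd
      (C := M) fun u hu => hM z u hz (by rw [mem_sphere_zero_iff_norm.1 hu]; exact hr'r.le)
    rw [norm_mul, norm_inv, Complex.norm_natCast, inv_pow]
    have h2 : (0 : ℝ) < k.factorial := by exact_mod_cast k.factorial_pos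
    rw [inv_mul_le_iff₀ h2]
    calc _ ≤ _ := h1
      _ = _ := by ring
  · have := Complex.hasSum_taylorSeries_on_ball (differentiableOn_regularPart F hr hRr hz)
      (z := u) (mem_ball_zero_iff.2 (by linarith))
    refine this.congr_fun ?_
    intro k
    simp only [sub_zero, smul_eq_mul]
    ring

end

/-! ### Factoring out `(1 - u) ^ (-z)` and comparing coefficients -/

section
open Filter Topology
variable (F : Type*) [Field F] [Finite F]

/-- Logarithm of the Euler product at `z = 1`. For real `t` every factor is positive, so multiplying
by `z` and exponentiating later raises no question of branches. -/
theorem hasSum_log_one_sub_pow {t : ℝ} (ht0 : 0 < t) (ht : Nat.card F * t < 1) :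
    HasSum (fun P : PrimesGeTwo F => Real.log (1 - t ^ P.1.natDegree))
      (Real.log (1 - Nat.card F * t) - Nat.card F * Real.log (1 - t)) := by
  have hq := two_le_natCard F
  have ht1 : t < 1 := by nlinarith
  have hn : ‖(t : ℂ)‖ = t := by simp [abs_of_pos ht0]
  obtain ⟨A, hA, hT⟩ := exists_hasSum_rootFreeSum F (z := 1) (t := t)
    (by simpa [hn, abs_of_pos ht0] using ht)
  set B : ℝ := (1 - t) ^ Nat.card F / (1 - Nat.card F * t) with hB
  have hB0 : 0 < B := div_pos (pow_pos (by linarith) _) (by linarith)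
  have hAB : A = B := by
    rw [hA.unique (hasSum_rootFreeSum_one F ht0.le ht), hB]
    push_cast; rfl
  have h1 : Tendsto (fun T : Finset (PrimesGeTwo F) =>
      (∏ P ∈ T, (1 - t ^ P.1.natDegree)) * B) atTop (𝓝 1) := by
    rw [← Complex.ofReal_one, hAB] at hT
    have : ∀ T : Finset (PrimesGeTwo F),
        (∏ P ∈ T, ((1 : ℝ) - (1 : ℝ) * (t : ℂ) ^ P.1.natDegree)) * (B : ℂ) =
          (((∏ P ∈ T, (1 - t ^ P.1.natDegree)) * B : ℝ) : ℂ) := by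
      intro T; push_cast; simp
    simp_rw [this] at hT
    exact (Complex.continuous_re.tendsto _).comp hT
  have hpos : ∀ P : PrimesGeTwo F, 0 < 1 - t ^ P.1.natDegree := fun P => by
    have := pow_lt_one₀ ht0.le ht1 (n := P.1.natDegree) (by have := P.2.2.2; omega)
    linarith
  have h2 := (h1.log one_ne_zero).sub_const (Real.log B)
  have h3 : 0 - Real.log B = Real.log (1 - Nat.card F * t) - Nat.card F * Real.log (1 - t) := by
    rw [hB, Real.log_div (pow_pos (by linarith) _).ne' (by linarith), Real.log_pow]
    ring
  rw [Real.log_one, h3] at h2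
  refine h2.congr fun T => ?_
  rw [Real.log_mul (Finset.prod_pos fun P _ => hpos P).ne' hB0.ne',
    Real.log_prod fun P _ => (hpos P).ne']
  ring

theorem one_sub_ofReal_cpow {x : ℝ} (hx : x < 1) (w : ℂ) :
    (1 - (x : ℂ)) ^ w = Complex.exp (w * Real.log (1 - x)) := by
  have h : (1 : ℂ) - x = ((1 - x : ℝ) : ℂ) := by push_cast; rfl
  have h0 : ((1 - x : ℝ) : ℂ) ≠ 0 := by
    exact_mod_cast (by linarith : (0 : ℝ) < 1 - x).ne'
  rw [h, Complex.cpow_def_of_ne_zero h0, ← Complex.ofReal_log (by linarith), mul_comm]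

theorem hasSum_rootFreeSum {z : ℂ} {t : ℝ} (ht0 : 0 < t)
    (h : Nat.card F * (max 1 ‖z‖ * t) < 1) :
    HasSum (fun n => rootFreeSum F n z * (t : ℂ) ^ n)
      (regularPart F z (Nat.card F * t) * (1 / (1 - Nat.card F * t : ℂ) ^ z)) := by
  have hq := two_le_natCard F
  have hq0 : (Nat.card F : ℂ) ≠ 0 := by
    exact_mod_cast (by linarith : (0 : ℝ) < Nat.card F).ne'
  have ht : Nat.card F * t < 1 := by
    refine lt_of_le_of_lt ?_ h
    gcongr
    nlinarith [le_max_left 1 ‖z‖]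
  have ht1 : t < 1 := by nlinarith
  have hn : ‖(t : ℂ)‖ = t := by simp [abs_of_pos ht0]
  obtain ⟨A, hA, hT⟩ := exists_hasSum_rootFreeSum F (z := z) (t := t) (by rwa [hn])
  -- If `A` were zero, the finite products times `A` could not tend to `1`.
  have hA0 : A ≠ 0 := by
    rintro rfl
    simp at hT
  have h1 : HasProd (fun P : PrimesGeTwo F => (1 - z * (t : ℂ) ^ P.1.natDegree)⁻¹) A := by
    have h2 := (hT.mul_const A⁻¹).inv₀ (by simpa using hA0)
    simp only [mul_assoc, mul_inv_cancel₀ hA0, mul_one, one_mul, inv_inv] at h2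
    refine h2.congr fun T => ?_
    rw [Finset.prod_inv_distrib]
  have h3 : HasProd (fun P : PrimesGeTwo F => (1 - (t : ℂ) ^ P.1.natDegree) ^ z)
      (Complex.exp (z * ((Real.log (1 - Nat.card F * t) -
        Nat.card F * Real.log (1 - t) : ℝ) : ℂ))) := by
    have h4 := ((Complex.hasSum_ofReal.2 (hasSum_log_one_sub_pow F ht0 ht)).mul_left z).cexp
    refine h4.congr_fun fun P => ?_
    have hP : t ^ P.1.natDegree < 1 :=
      pow_lt_one₀ ht0.le ht1 (by have := P.2.2.2; omega)
    rw [← Complex.ofReal_pow, one_sub_ofReal_cpow hP]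
    rfl
  have h5 := (h1.mul h3).tprod_eq
  have h6 : (Nat.card F : ℂ) * t = ((Nat.card F * t : ℝ) : ℂ) := by push_cast; rfl
  convert hA using 1
  unfold regularPart localFactor
  rw [mul_div_cancel_left₀ _ hq0, h5, one_sub_ofReal_cpow ht1, h6, one_sub_ofReal_cpow ht, one_div,
    ← Complex.exp_neg]
  rw [mul_comm A, ← mul_assoc, ← Complex.exp_add, mul_right_comm, ← Complex.exp_add]
  push_cast
  ring_nf
  simp

/-- A power series vanishing at all small positive reals is zero. -/
theorem eq_zero_of_hasSum_zero {e : ℕ → ℂ} {x : ℝ} (hx : 0 < x)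
    (h : ∀ u : ℝ, 0 < u → u < x → HasSum (fun n => e n * (u : ℂ) ^ n) 0) (n : ℕ) : e n = 0 := by
  set p := FormalMultilinearSeries.ofScalars ℂ e with hp
  have hsum : Summable fun n => ‖e n * ((x / 2 : ℝ) : ℂ) ^ n‖ :=
    (h (x / 2) (by linarith) (by linarith)).summable.norm
  have hrad : ((x / 2).toNNReal : ENNReal) ≤ p.radius := by
    refine p.le_radius_of_summable ?_
    refine hsum.congr fun n => ?_
    rw [Real.coe_toNNReal _ (by linarith), norm_mul, norm_pow, Complex.norm_real, Real.norm_eq_abs,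
      abs_of_pos (by linarith), hp, FormalMultilinearSeries.ofScalars_norm]
  have hpos : 0 < p.radius := lt_of_lt_of_le (by simpa using hx) hrad
  have hps := (p.hasFPowerSeriesOnBall hpos).hasFPowerSeriesAt
  have hfreq : ∃ᶠ u in 𝓝[≠] (0 : ℂ), p.sum u = 0 := by
    have h1 : Tendsto (fun u : ℝ => (u : ℂ)) (𝓝[>] 0) (𝓝[≠] 0) := by
      refine tendsto_nhdsWithin_iff.2 ⟨?_, ?_⟩
      · have := (Complex.continuous_ofReal.tendsto 0).mono_left
          (nhdsWithin_le_nhds : 𝓝[>] (0 : ℝ) ≤ 𝓝 0)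
        simpa using this
      · filter_upwards [self_mem_nhdsWithin] with u hu
        simpa using (Set.mem_Ioi.1 hu).ne'
    refine h1.frequently (Eventually.frequently ?_)
    filter_upwards [Ioo_mem_nhdsGT hx] with u hu
    rw [FormalMultilinearSeries.sum, ← (h u hu.1 hu.2).tsum_eq]
    refine tsum_congr fun n => ?_
    simp [hp, FormalMultilinearSeries.ofScalars]
  have hev := (hps.analyticAt.frequently_zero_iff_eventually_zero).1 hfreq
  have h0 : p = 0 := hps.locally_zero_iff.1 hev
  have h1 : p.coeff n = e n := by simp [hp]
  rw [← h1, h0]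
  rfl

theorem hasSum_multichoose {z u : ℂ} (hu : ‖u‖ < 1) :
    HasSum (fun n => Ring.multichoose z n * u ^ n) (1 / (1 - u) ^ z) := by
  have h := (Complex.one_div_one_sub_cpow_hasFPowerSeriesOnBall_zero z).hasSum (y := u)
    (by simpa [enorm_eq_nnnorm] using! hu)
  rw [zero_add] at h
  refine h.congr_fun fun n => ?_
  have e : z + n - 1 - n + 1 = z := by ring
  simp [FormalMultilinearSeries.ofScalars, Ring.choose, e]

theorem rootFreeSum_eq_sum_antidiagonal {z : ℂ} {g : ℕ → ℂ}
    (hg : ∀ u : ℂ, ‖u‖ ≤ 1 → HasSum (fun k => g k * u ^ k) (regularPart F z u)) (n : ℕ) :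
    rootFreeSum F n z =
      (Nat.card F : ℂ) ^ n * ∑ p ∈ Finset.HasAntidiagonal.antidiagonal n, g p.1 * Ring.multichoose z p.2 := by
  have hq := two_le_natCard F
  have hq0 : (Nat.card F : ℝ) ≠ 0 := by linarith
  have hqc : (Nat.card F : ℂ) ≠ 0 := by exact_mod_cast hq0
  have hm : (1 : ℝ) ≤ max 1 ‖z‖ := le_max_left _ _
  -- With `t = u / q`, this range of `u` is exactly where the Euler product identity was
  -- established; small positive reals suffice to identify coefficients.
  have key := eq_zero_of_hasSum_zero (x := 1 / max 1 ‖z‖) (by positivity)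
    (e := fun n => rootFreeSum F n z / (Nat.card F : ℂ) ^ n -
      ∑ p ∈ Finset.HasAntidiagonal.antidiagonal n, g p.1 * Ring.multichoose z p.2) ?_ n
  · rw [sub_eq_zero, div_eq_iff (pow_ne_zero _ hqc)] at key
    rw [key, mul_comm]
  · intro u hu0 hu1
    rw [lt_div_iff₀ (by positivity)] at hu1
    have hu1' : u < 1 := by nlinarith
    have hn : ‖(u : ℂ)‖ = u := by simp [abs_of_pos hu0]
    have h1 := hasSum_rootFreeSum F (z := z) (t := u / Nat.card F) (by positivity) (by
      rw [← mul_div_assoc, mul_div_cancel₀ _ hq0]; linarith)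
    have e1 : (Nat.card F : ℂ) * ((u / Nat.card F : ℝ) : ℂ) = u := by
      push_cast; field_simp
    rw [e1] at h1
    have h2 := hg u (by rw [hn]; exact hu1'.le)
    have h3 := hasSum_multichoose (z := z) (u := u) (by rwa [hn])
    have h4 := tsum_mul_tsum_eq_tsum_sum_antidiagonal_of_summable_norm h2.summable.norm
      h3.summable.norm
    have h5 := (summable_norm_sum_mul_antidiagonal_of_summable_norm h2.summable.norm
      h3.summable.norm).of_norm.hasSum
    rw [← h4, h2.tsum_eq, h3.tsum_eq] at h5
    have h6 := h1.sub h5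
    rw [sub_self] at h6
    refine h6.congr_fun fun n => ?_
    rw [sub_mul, Finset.sum_mul]
    congr 1
    · push_cast; rw [div_pow]; ring
    · refine Finset.sum_congr rfl fun p hp => ?_
      rw [← Finset.HasAntidiagonal.mem_antidiagonal.1 hp, pow_add]
      ring

end

/-! ### Conclusion -/

theorem inv_Gamma_mul_regularPart_one (F : Type*) [Field F] (z : ℂ) :
    (Complex.Gamma z)⁻¹ * regularPart F z 1 = z * hFun F z := by
  have h := Complex.one_div_Gamma_eq_self_mul_one_div_Gamma_add_one z
  rw [hFun, regularPart]
  simp_rw [eulerFactor_eq_localFactor]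
  rw [h, one_div]
  ring

theorem proposition1p4 (F : Type*) [Field F] [Finite F] :
    (∀ z : ℂ, ‖z‖ < (Nat.card F : ℝ) ^ 2 → Multipliable (eulerFactor F z)) ∧
    AnalyticOnNhd ℂ (hFun F) (Metric.ball 0 ((Nat.card F : ℝ) ^ 2)) ∧
    ∀ δ : ℝ, 0 < δ → δ < 1 →
      ∃ C : ℝ, ∀ n : ℕ, 1 ≤ n → ∀ z : ℂ, ‖z‖ ≤ (Nat.card F : ℝ) ^ 2 - δ →
        ∃ ε : ℂ, ‖ε‖ ≤ C / (n : ℝ) ∧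
          rootFreeSum F n z =
            (Nat.card F : ℂ) ^ n * (n : ℂ) ^ (z - 1) * (z * hFun F z + ε) := by
  refine ⟨fun z hz => multipliable_eulerFactor F hz, analyticOnNhd_hFun F, fun δ hδ _ => ?_⟩
  obtain ⟨M, s, hs0, hs, hg⟩ := exists_taylor_regularPart F
    (R := (Nat.card F : ℝ) ^ 2 - δ) (by linarith)
  obtain ⟨C, hC⟩ := exists_coeff_bound ((Nat.card F : ℝ) ^ 2 - δ) M hs0 hs
  refine ⟨C, fun n hn z hz => ?_⟩
  obtain ⟨g, hgb, hgs⟩ := hg z hz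
  have hG : ∑' k, g k = regularPart F z 1 := by
    simpa using (hgs 1 (by simp)).tsum_eq
  have h := hC z hz g hgb n hn
  rw [hG, inv_Gamma_mul_regularPart_one] at h
  -- The witness is the normalised error itself, read off from `h`; what remains is the cancellation
  -- of `n ^ (z - 1)` and `n ^ (1 - z)`.
  refine ⟨_, h, ?_⟩
  have hn0 : (n : ℂ) ≠ 0 := by exact_mod_cast (by omega : n ≠ 0)
  have hpow : (n : ℂ) ^ (z - 1) * (n : ℂ) ^ (1 - z) = 1 := by
    rw [← Complex.cpow_add _ _ hn0]; simp
  rw [rootFreeSum_eq_sum_antidiagonal F hgs n]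
  linear_combination -(Nat.card F : ℂ) ^ n *
    (∑ p ∈ Finset.HasAntidiagonal.antidiagonal n, g p.1 * Ring.multichoose z p.2) * hpow
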